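/- Let $n\ge 2$. Let $P_i^{(n)}$ ($i\ge 0$) be the Gegenbauer polynomials: $\deg P_i^{(n)}=i$, $P_i^{(n)}(1)=1$, orthogonal on $[-1,1]$ with respect to $(1-t^2)^{(n-3)/2}\,dt$; equivalently $P_0^{(n)}=1$, $P_1^{(n)}=t$ and $(j+n-2)P_{j+1}^{(n)}=(2j+n-2)\,t\,P_j^{(n)}-jP_{j-1}^{(n)}$ for $j\ge1$. For a real polynomial $f=\sum_i f_iP_i^{(n)}$ let $f_0$ denote its coefficient at $P_0^{(n)}$. A weighted spherical code $(C,W)$ on $\mathbb S^{n-1}$ consists of distinct points $x_1,\dots,x_N\in\mathbb S^{n-1}$ and weights $w_1,\dots,w_N>0$ with $\sum_i w_i=1$. Put $N_W=1/\sum_i w_i^2$ and $E_h(C,W)=\sum_{i\ne j}w_iw_jh(x_i\cdot x_j)$. It is a weighted spherical $\tau$-design if $\sum_{i,j}w_iw_jP_\ell^{(n)}(x_i\cdot x_j)=0$ for $1\le \ell\le\tau$. For $m=2k-1+\varepsilon$ with $k\ge 1$, $\varepsilon\in\{0,1\}$, put $D(n,m)=\binom{n+k-2+\varepsilon}{n-1}+\binom{n+k-2}{n-1}$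 and $$L_m(n,s)=\binom{k+n-3+\varepsilon}{n-2}\left[\frac{2k+n-3+2\varepsilon}{n-1}-\frac{(1+s)^{\varepsilon}\left(P_{k-1+\varepsilon}^{(n)}(s)-P_{k+\varepsilon}^{(n)}(s)\right)}{(1-s)\left(\varepsilon P_k^{(n)}(s)+P_{k+\varepsilon}^{(n)}(s)\right)}\right].$$ Let $\tau=2k-1+\varepsilon$ with $k\ge1$, $\varepsilon\in\{0,1\}$, and let $(C,W)$ be a weighted spherical $\tau$-design on $\mathbb S^{n-1}$ with $D(n,\tau)<N_W\le D(n,\tau+1)$. Let $h$ be a real-valued continuous function on $[-1,1)$ (it may tend to $+\infty$ at $1$) that is $\tau+1$ times differentiable on $(-1,1)$ with $h^{(\tau+1)}\ge0$ there. Then the following parameters are well defined: $\alpha_0<\alpha_1<\dots<\alpha_{k-1+\varepsilon}$ are the real solutions $s$ of $L_\tau(n,s)=N_W$ (where the denominator does not vanish), together with the point $-1$ if $\varepsilon=1$ (there are exactly $k+\varepsilon$ such numbers, and all lie in $[-1,1)$), and $\rho_i$ is determined by $(\ell_i)_0=\ell_i(1)/N_W+\rho_i\,\ell_i(\alpha_i)$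 with $\ell_i(t)=\prod_{j\ne i}(t-\alpha_j)$. With these parameters $$E_h(C,W)\ \ge\ \sum_{i=0}^{k-1+\varepsilon}\rho_i\,h(\alpha_i).$$ This bound cannot be improved by any polynomial of degree at most $\tau$ lying below $h$: $\sum_i\rho_ih(\alpha_i)$ is the maximum of $f_0-f(1)\sum_{i=1}^N w_i^2$ over all real polynomials $f$ with $\deg f\le\tau$ and $f(t)\le h(t)$ for all $t\in[-1,1)$. -/

import Mathlib

open Polynomial

noncomputable section

/-- The Gegenbauer polynomials `P_i^{(n)}` normalized by `P_i^{(n)}(1) = 1`, i.e. the orthogonal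
polynomials of the weight `(1 - t^2)^((n-3)/2)` on `[-1,1]`, given by their three-term recurrence
`(j + n - 2) P_{j+1} = (2j + n - 2) t P_j - j P_{j-1}` (here with `j = i + 1`). -/
def gegenbauer (n : ℕ) : ℕ → ℝ[X]
  | 0 => 1
  | 1 => X
  | (i + 2) => C (1 / ((i : ℝ) + n - 1)) *
      (C (2 * (i : ℝ) + n) * X * gegenbauer n (i + 1) - C ((i : ℝ) + 1) * gegenbauer n i)

theorem gegenbauer_degree (n : ℕ) (hn : 2 ≤ n) (i : ℕ) : (gegenbauer n i).degree = i := by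
  have hn' : (2 : ℝ) ≤ n := by exact_mod_cast hn
  induction i using Nat.strong_induction_on with
  | _ i ih =>
    match i, ih with
    | 0, _ => simp [gegenbauer]
    | 1, _ => simp [gegenbauer]
    | (i + 2), ih =>
      have h0 := ih i (by omega)
      have h1 := ih (i + 1) (by omega)
      have hi : (0 : ℝ) ≤ i := Nat.cast_nonneg i
      have hc : (1 / ((i : ℝ) + n - 1)) ≠ 0 := by
        apply one_div_ne_zero; linarith
      have hd : (2 * (i : ℝ) + n) ≠ 0 := by linarith
      have he : ((i : ℝ) + 1) ≠ 0 := by linarith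
      have hA : (C (2 * (i : ℝ) + n) * X * gegenbauer n (i + 1)).degree = ((i + 2 : ℕ) : WithBot ℕ) := by
        rw [degree_mul, degree_C_mul_X hd, h1]
        norm_cast
        omega
      have hB : (C ((i : ℝ) + 1) * gegenbauer n i).degree = (i : WithBot ℕ) := by
        rw [degree_C_mul he, h0]
      rw [gegenbauer, degree_C_mul hc, degree_sub_eq_left_of_degree_lt, hA]
      rw [hA, hB]
      exact_mod_cast (by omega : i < i + 2)

theorem gegenbauer_one (n : ℕ) (hn : 2 ≤ n) (i : ℕ) : (gegenbauer n i).eval 1 = 1 := by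
  have hn' : (2 : ℝ) ≤ n := by exact_mod_cast hn
  induction i using Nat.strong_induction_on with
  | _ i ih =>
    match i, ih with
    | 0, _ => simp [gegenbauer]
    | 1, _ => simp [gegenbauer]
    | (i + 2), ih =>
      have h0 := ih i (by omega)
      have h1 := ih (i + 1) (by omega)
      have hi : (0 : ℝ) ≤ i := Nat.cast_nonneg i
      have hc : ((i : ℝ) + n - 1) ≠ 0 := by linarith
      simp only [gegenbauer, eval_mul, eval_sub, eval_C, eval_X, h0, h1]
      field_simp
      ring

/-- The Gegenbauer polynomials as a basis of `ℝ[X]`. -/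
def gegenbauerBasis (n : ℕ) (hn : 2 ≤ n) : Module.Basis ℕ ℝ ℝ[X] :=
  Polynomial.Sequence.basis ⟨gegenbauer n, gegenbauer_degree n hn⟩ (fun i => by
    rw [isUnit_iff_ne_zero, Ne, leadingCoeff_eq_zero]
    exact Polynomial.Sequence.ne_zero _ i)

/-- The coefficient `f_i` in the Gegenbauer expansion `f = ∑ f_i P_i^{(n)}`. -/
def gegenbauerCoeff (n : ℕ) (hn : 2 ≤ n) (f : ℝ[X]) (i : ℕ) : ℝ :=
  (gegenbauerBasis n hn).repr f i

/-- A weighted spherical code on `𝕊^{n-1}`: `N` distinct unit vectors with positive weights of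
total mass one. -/
structure WeightedSphericalCode (n N : ℕ) where
  point : Fin N → EuclideanSpace ℝ (Fin n)
  weight : Fin N → ℝ
  norm_point : ∀ i, ‖point i‖ = 1
  injective_point : Function.Injective point
  weight_pos : ∀ i, 0 < weight i
  weight_sum : ∑ i, weight i = 1

namespace WeightedSphericalCode

variable {n N : ℕ} (CW : WeightedSphericalCode n N)

/-- The weighted energy `∑_{i ≠ j} w_i w_j h(x_i ⬝ x_j)`. -/
def energy (h : ℝ → ℝ) : ℝ :=
  ∑ i, ∑ j ∈ Finset.univ.erase i,
    CW.weight i * CW.weight j * h (inner ℝ (CW.point i) (CW.point j))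

/-- The weighted moment `M_ℓ = ∑_{i,j} w_i w_j P_ℓ^{(n)}(x_i ⬝ x_j)`. -/
def moment (l : ℕ) : ℝ :=
  ∑ i, ∑ j, CW.weight i * CW.weight j *
    (gegenbauer n l).eval (inner ℝ (CW.point i) (CW.point j))

/-- Weighted spherical `τ`-designs. -/
def IsDesign (τ : ℕ) : Prop :=
  ∀ l, 1 ≤ l → l ≤ τ → CW.moment l = 0

/-- `N_W = 1 / ∑ w_i^2`. -/
def effectiveSize : ℝ :=
  1 / ∑ i, CW.weight i ^ 2

end WeightedSphericalCode

/-- The Delsarte–Goethals–Seidel number `D(n,m)`, where `m = 2k - 1 + ε` with `ε ∈ {0,1}`, so that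
`k = (m + 1) / 2` and `ε = (m + 1) % 2`. -/
def dgsBound (n m : ℕ) : ℕ :=
  (n + (m + 1) / 2 - 2 + (m + 1) % 2).choose (n - 1) + (n + (m + 1) / 2 - 2).choose (n - 1)

/-- The denominator `(1 - s) (ε P_k(s) + P_{k+ε}(s))` in the Levenshtein function. -/
def levenshteinDenom (n k ε : ℕ) (s : ℝ) : ℝ :=
  (1 - s) * ((ε : ℝ) * (gegenbauer n k).eval s + (gegenbauer n (k + ε)).eval s)

/-- The Levenshtein function `L_m(n,s)`, `m = 2k - 1 + ε`. -/
def levenshteinL (n k ε : ℕ) (s : ℝ) : ℝ :=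
  ((k + n - 3 + ε).choose (n - 2) : ℝ) *
    ((2 * (k : ℝ) + n - 3 + 2 * ε) / ((n : ℝ) - 1) -
      (1 + s) ^ ε * ((gegenbauer n (k - 1 + ε)).eval s - (gegenbauer n (k + ε)).eval s) /
        levenshteinDenom n k ε s)

/-- The nodes: the solutions `s` of `L_m(n,s) = M`, together with `-1` if `ε = 1`. -/
def levenshteinNodes (n k ε : ℕ) (M : ℝ) : Set ℝ :=
  {s | levenshteinDenom n k ε s ≠ 0 ∧ levenshteinL n k ε s = M} ∪ {s | ε = 1 ∧ s = -1}

/-- The (unnormalized) Lagrange basis polynomial `∏_{j ≠ i} (t - α_j)`. -/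
def lagrangePoly {r : ℕ} (α : Fin r → ℝ) (i : Fin r) : ℝ[X] :=
  ∏ j ∈ Finset.univ.erase i, (X - C (α j))

/-- `(α_i, ρ_i)`, `0 ≤ i ≤ k - 1 + ε`, are the nodes and weights attached to `M`: the `α_i` enumerate
the nodes increasingly, and `ρ_i` is obtained by substituting the Lagrange basis polynomial `ℓ_i` for
`f` in the formula `f_0 = f(1) / M + ∑ ρ_j f(α_j)` (all terms but the one with `j = i` vanish).
The formula is imposed for no other polynomials. -/
structure IsLevenshteinParameters (n : ℕ) (hn : 2 ≤ n) (k ε : ℕ) (M : ℝ)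
    (α ρ : Fin (k + ε) → ℝ) : Prop where
  strictMono : StrictMono α
  range_eq : Set.range α = levenshteinNodes n k ε M
  weight_eq : ∀ i, gegenbauerCoeff n hn (lagrangePoly α i) 0 =
    (lagrangePoly α i).eval 1 / M + ρ i * (lagrangePoly α i).eval (α i)

end

/-!
The argument is the linear programming method, with the positivity coming from the code itself.

On polynomials of degree at most `τ` the energy of a `τ`-design is the functional
`L f = f_0 - f(1) / N_W` (`WeightedSphericalCode.IsDesign.energy_eval`), and the energy is a positive
measure carried by the inner products `x_i ⬝ x_j`, `i ≠ j`, all in `[-1,1)`. The nodes and weights are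
those of the Gauss (`ε = 0`) or Gauss–Radau (`ε = 1`, with `-1` prescribed) quadrature of `L`.

To see this, let `m = k - 1 + ε` and let `K_m = ∑_{i ≤ m} r_i P_i` be the polynomial with
`(f K_m)_0 = f(1)` whenever `deg f ≤ m`. The Christoffel–Darboux formula
`(1 - t) K_m = c_m (P_m - P_{m+1})` turns the equation `L_τ(n,s) = N_W` into the vanishing of `nodePoly`
(`levenshteinNodes_eq`), and the reproducing property shows that this polynomial is orthogonal under
`L` to all polynomials of degree less than `k` (`gegenbauerMean_nodePoly_mul`). Since
`K_m(1) ≤ D(n,τ) < N_W`, the form `L (g²)` is positive definite in degree at most `m`, so that a nonzero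
`g` of that degree cannot vanish at all inner products
(`WeightedSphericalCode.IsDesign.eq_zero_of_eval_inner`). The classical argument on the zeros of
orthogonal polynomials then gives `k` simple zeros in `(-1,1)`, besides `-1` when `ε = 1`
(`WeightedSphericalCode.IsDesign.exists_nodes`). Division by the node polynomial gives the quadrature
formula `L f = ∑ ρ_i f(α_i)` in degree at most `τ` (`gegenbauerMean_eq_quadrature`), and `f = ℓ_i²`
gives `ρ_i ≥ 0`.

Hence `L f ≤ ∑ ρ_i h(α_i)` for every admissible `f`. Equality holds for the polynomial that
interpolates `h` doubly at the nodes in `(-1,1)` and simply at `-1`; it lies below `h` because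
`h^{(τ+1)} ≥ 0` (`exists_hermite_le`), and comparing energies gives the lower bound.
-/

open Polynomial

noncomputable section

/-! ### Gegenbauer polynomials -/

section Gegenbauer

variable {n : ℕ}

/-- The mean `f ↦ f_0`, the coordinate at `P_0`, as a linear functional. -/
def gegenbauerMean (n : ℕ) (hn : 2 ≤ n) : ℝ[X] →ₗ[ℝ] ℝ := (gegenbauerBasis n hn).coord 0

theorem gegenbauerCoeff_zero_eq (hn : 2 ≤ n) (f : ℝ[X]) :
    gegenbauerCoeff n hn f 0 = gegenbauerMean n hn f := rfl

theorem gegenbauerBasis_apply (hn : 2 ≤ n) (i : ℕ) :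
    gegenbauerBasis n hn i = gegenbauer n i :=
  Polynomial.Sequence.basis_eq_self _ _ i

theorem gegenbauerMean_gegenbauer (hn : 2 ≤ n) (i : ℕ) :
    gegenbauerMean n hn (gegenbauer n i) = if i = 0 then 1 else 0 := by
  rw [← gegenbauerBasis_apply hn, gegenbauerMean, Module.Basis.coord_apply,
    Module.Basis.repr_self, Finsupp.single_apply]

theorem gegenbauer_natDegree (hn : 2 ≤ n) (i : ℕ) : (gegenbauer n i).natDegree = i :=
  natDegree_eq_of_degree_eq_some (gegenbauer_degree n hn i)

theorem gegenbauer_mem_of_natDegree_le (hn : 2 ≤ n) (S : Submodule ℝ ℝ[X]) {d : ℕ}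
    (hS : ∀ l ≤ d, gegenbauer n l ∈ S) {f : ℝ[X]} (hf : f.natDegree ≤ d) : f ∈ S := by
  have hspan := Polynomial.Sequence.span_degreeLE
    (⟨gegenbauer n, gegenbauer_degree n hn⟩ : Polynomial.Sequence ℝ) (m := d) (fun i _ => by
      rw [isUnit_iff_ne_zero, Ne, leadingCoeff_eq_zero]
      exact Polynomial.Sequence.ne_zero _ i)
  have hfd : f ∈ degreeLE ℝ d := mem_degreeLE.2 (natDegree_le_iff_degree_le.1 hf)
  rw [← hspan] at hfd
  refine (Submodule.span_le.2 ?_) hfd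
  rintro _ ⟨l, hl, rfl⟩
  exact hS l hl

/-- The three-term recurrence, solved for the product `t P_{i+1}`. -/
theorem X_mul_gegenbauer (hn : 2 ≤ n) (i : ℕ) :
    X * gegenbauer n (i + 1) = C (((i : ℝ) + n - 1) / (2 * i + n)) * gegenbauer n (i + 2) +
      C (((i : ℝ) + 1) / (2 * i + n)) * gegenbauer n i := by
  have hn' : (2 : ℝ) ≤ n := by exact_mod_cast hn
  have hi : (0 : ℝ) ≤ i := Nat.cast_nonneg i
  have h1 : (i : ℝ) + n - 1 ≠ 0 := by linarith
  have h2 : 2 * (i : ℝ) + n ≠ 0 := by linarith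
  refine Polynomial.funext fun x => ?_
  simp only [gegenbauer, eval_mul, eval_add, eval_sub, eval_C, eval_X]
  field_simp
  ring

theorem gegenbauerMean_X_pow_mul (hn : 2 ≤ n) (l : ℕ) : ∀ j, l < j →
    gegenbauerMean n hn (X ^ l * gegenbauer n j) = 0 := by
  induction l with
  | zero => intro j hj; rw [pow_zero, one_mul, gegenbauerMean_gegenbauer, if_neg hj.ne']
  | succ l ih =>
    intro j hj
    obtain ⟨i, rfl⟩ : ∃ i, j = i + 1 := ⟨j - 1, by omega⟩
    rw [pow_succ, mul_assoc, X_mul_gegenbauer hn, mul_add, mul_left_comm, mul_left_comm (X ^ l),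
      map_add, ← smul_eq_C_mul, ← smul_eq_C_mul, map_smul, map_smul, ih _ (by omega),
      ih _ (by omega)]
    simp

/-- `P_j` is orthogonal to every polynomial of smaller degree. -/
theorem gegenbauerMean_mul_gegenbauer (hn : 2 ≤ n) {f : ℝ[X]} {j : ℕ} (hf : f.natDegree < j) :
    gegenbauerMean n hn (f * gegenbauer n j) = 0 := by
  conv_lhs => rw [f.as_sum_range_C_mul_X_pow, Finset.sum_mul, map_sum]
  refine Finset.sum_eq_zero fun l hl => ?_
  rw [mul_assoc, ← smul_eq_C_mul, map_smul,
    gegenbauerMean_X_pow_mul hn l j (by have := Finset.mem_range.1 hl; omega), smul_zero]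

theorem gegenbauerMean_gegenbauer_mul_self_pos (hn : 2 ≤ n) (j : ℕ) :
    0 < gegenbauerMean n hn (gegenbauer n j * gegenbauer n j) := by
  have hn' : (2 : ℝ) ≤ n := by exact_mod_cast hn
  have hstep : ∀ i, gegenbauerMean n hn (gegenbauer n i * (X * gegenbauer n (i + 1))) =
      ((i : ℝ) + 1) / (2 * i + n) * gegenbauerMean n hn (gegenbauer n i * gegenbauer n i) := by
    intro i
    rw [X_mul_gegenbauer hn, mul_add, mul_left_comm, mul_left_comm _ (C _), map_add,
      ← smul_eq_C_mul, ← smul_eq_C_mul, map_smul, map_smul,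
      gegenbauerMean_mul_gegenbauer hn (j := i + 2) (by rw [gegenbauer_natDegree hn]; omega)]
    simp
  induction j with
  | zero =>
    have : gegenbauer n 0 * gegenbauer n 0 = gegenbauer n 0 := by simp [gegenbauer]
    rw [this, gegenbauerMean_gegenbauer]; simp
  | succ j ih =>
    have hj := hstep j
    have hpos : 0 < ((j : ℝ) + 1) / (2 * j + n) *
        gegenbauerMean n hn (gegenbauer n j * gegenbauer n j) := by positivity
    rw [← hj] at hpos
    match j with
    | 0 => simpa [gegenbauer] using hpos
    | i + 1 =>
      rw [← mul_assoc, mul_comm _ X, X_mul_gegenbauer hn, add_mul, mul_assoc, mul_assoc, map_add,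
        ← smul_eq_C_mul, ← smul_eq_C_mul, map_smul, map_smul,
        gegenbauerMean_mul_gegenbauer hn (j := i + 1 + 1) (f := gegenbauer n i)
          (by rw [gegenbauer_natDegree hn]; omega)] at hpos
      simp only [smul_eq_mul, mul_zero, add_zero] at hpos
      refine pos_of_mul_pos_right hpos (div_nonneg ?_ ?_) <;>
        linarith [(Nat.cast_nonneg i : (0 : ℝ) ≤ i)]

/-- The mean is a positive definite functional. -/
theorem gegenbauerMean_mul_self_pos (hn : 2 ≤ n) {f : ℝ[X]} (hf : f ≠ 0) :
    0 < gegenbauerMean n hn (f * f) := by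
  induction hd : f.natDegree using Nat.strong_induction_on generalizing f with
  | _ d ih =>
    set a := f.leadingCoeff / (gegenbauer n d).leadingCoeff with ha
    have hPd : gegenbauer n d ≠ 0 := fun h0 => by
      simpa [h0] using gegenbauer_degree n hn d
    have hlc : (gegenbauer n d).leadingCoeff ≠ 0 := leadingCoeff_ne_zero.2 hPd
    have ha0 : a ≠ 0 := div_ne_zero (leadingCoeff_ne_zero.2 hf) hlc
    set g := f - C a * gegenbauer n d with hg
    have hfg : f = C a * gegenbauer n d + g := by rw [hg]; ring
    have hdeg : g.degree < f.degree := by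
      refine degree_sub_lt_left ?_ hf ?_
      · rw [degree_C_mul ha0, gegenbauer_degree n hn, degree_eq_natDegree hf, hd]
      · rw [leadingCoeff_mul, leadingCoeff_C, ha, div_mul_cancel₀ _ hlc]
    have hsq : f * f = C (a * a) * (gegenbauer n d * gegenbauer n d) +
        (C (2 * a) * (g * gegenbauer n d) + g * g) := by
      rw [hfg]; simp only [C_mul, C_ofNat]; ring
    have hPP := gegenbauerMean_gegenbauer_mul_self_pos hn d
    have haa : 0 < a * a := mul_self_pos.2 ha0
    rw [hsq, map_add, map_add, ← smul_eq_C_mul, ← smul_eq_C_mul, map_smul, map_smul]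
    by_cases hg0 : g = 0
    · simp only [hg0, zero_mul, mul_zero, map_zero, add_zero, smul_eq_mul]
      exact mul_pos haa hPP
    · have hgd : g.natDegree < d := by rw [← hd]; exact natDegree_lt_natDegree hg0 hdeg
      rw [gegenbauerMean_mul_gegenbauer hn hgd, smul_zero, zero_add, smul_eq_mul]
      have := ih _ hgd hg0 rfl
      positivity

/-- The constant `C(k+n-2, n-2)` of the Christoffel–Darboux formula at `1`. -/
def darbouxConst (n k : ℕ) : ℝ := ((k + n - 2).choose (n - 2) : ℝ)

theorem darbouxConst_zero (n : ℕ) : darbouxConst n 0 = 1 := by simp [darbouxConst]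

theorem darbouxConst_pos (hn : 2 ≤ n) (k : ℕ) : 0 < darbouxConst n k := by
  rw [darbouxConst, Nat.cast_pos]
  exact Nat.choose_pos (by omega)

theorem darbouxConst_succ (hn : 2 ≤ n) (k : ℕ) :
    ((k : ℝ) + 1) * darbouxConst n (k + 1) = (k + n - 1) * darbouxConst n k := by
  obtain ⟨p, rfl⟩ : ∃ p, n = p + 2 := ⟨n - 2, by omega⟩
  have h := Nat.add_one_mul_choose_eq (k + p) k
  have e1 : k + 1 + (p + 2) - 2 = (k + p).succ := by omega
  have e2 : k + (p + 2) - 2 = k + p := by omega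
  have h1 : (k + p).succ.choose p = (k + p).succ.choose k.succ :=
    Nat.choose_symm_of_eq_add (by omega)
  have h2 : (k + p).choose p = (k + p).choose k := Nat.choose_symm_of_eq_add (by omega)
  simp only [darbouxConst, e1, e2, Nat.add_sub_cancel, h1, h2]
  have h' : ((k + p).succ : ℝ) * (k + p).choose k = (k + p).succ.choose k.succ * k.succ := by
    exact_mod_cast h
  push_cast at h' ⊢
  linarith

/-- The reproducing kernel at `1` of the polynomials of degree at most `m`, that is
`∑_{i ≤ m} r_i P_i(t)` with `r_i` the dimension of the space of spherical harmonics of degree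
`i`. -/
def kernelPoly (n : ℕ) : ℕ → ℝ[X]
  | 0 => 1
  | m + 1 => kernelPoly n m + C (darbouxConst n (m + 1) + darbouxConst n m) * gegenbauer n (m + 1)

theorem kernelPoly_natDegree_le (hn : 2 ≤ n) (m : ℕ) : (kernelPoly n m).natDegree ≤ m := by
  induction m with
  | zero => simp [kernelPoly]
  | succ m ih =>
    refine natDegree_add_le_of_degree_le (by omega) ?_
    exact (natDegree_C_mul_le _ _).trans (gegenbauer_natDegree hn _).le

/-- The Christoffel–Darboux formula at `1`. -/
theorem one_sub_X_mul_kernelPoly (hn : 2 ≤ n) (m : ℕ) :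
    (1 - X) * kernelPoly n m = C (darbouxConst n m) * (gegenbauer n m - gegenbauer n (m + 1)) := by
  have hn' : (2 : ℝ) ≤ n := by exact_mod_cast hn
  induction m with
  | zero => simp [kernelPoly, darbouxConst_zero, gegenbauer]
  | succ m ih =>
    have hm : (0 : ℝ) ≤ m := Nat.cast_nonneg m
    have hs := darbouxConst_succ hn m
    have hden : 2 * (m : ℝ) + n ≠ 0 := by linarith
    have ha : (darbouxConst n (m + 1) + darbouxConst n m) * (((m : ℝ) + n - 1) / (2 * m + n)) =
        darbouxConst n (m + 1) := by
      field_simp; linarith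
    have hb : (darbouxConst n (m + 1) + darbouxConst n m) * (((m : ℝ) + 1) / (2 * m + n)) =
        darbouxConst n m := by
      field_simp; linarith
    have hX : C (darbouxConst n (m + 1) + darbouxConst n m) * (X * gegenbauer n (m + 1)) =
        C (darbouxConst n (m + 1)) * gegenbauer n (m + 2) +
          C (darbouxConst n m) * gegenbauer n m := by
      rw [X_mul_gegenbauer hn, mul_add, ← mul_assoc, ← mul_assoc, ← C_mul, ← C_mul, ha, hb]
    rw [kernelPoly, mul_add, ih]
    have : (1 - X) * (C (darbouxConst n (m + 1) + darbouxConst n m) * gegenbauer n (m + 1)) =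
        C (darbouxConst n (m + 1) + darbouxConst n m) * gegenbauer n (m + 1) -
          C (darbouxConst n (m + 1) + darbouxConst n m) * (X * gegenbauer n (m + 1)) := by ring
    rw [this, hX]
    simp only [C_add]
    ring

theorem kernelPoly_eval_one (hn : 2 ≤ n) (m : ℕ) :
    (kernelPoly n m).eval 1 = darbouxConst n m * ((2 * m + n - 1) / (n - 1)) := by
  have hn' : (2 : ℝ) ≤ n := by exact_mod_cast hn
  have h1 : (n : ℝ) - 1 ≠ 0 := by linarith
  induction m with
  | zero => simp [kernelPoly, darbouxConst_zero, h1]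
  | succ m ih =>
    have hs := darbouxConst_succ hn m
    simp only [kernelPoly, eval_add, eval_mul, eval_C, gegenbauer_one n hn, ih]
    field_simp
    push_cast
    linarith

theorem kernelPoly_eval_one_pos (hn : 2 ≤ n) (m : ℕ) : 0 < (kernelPoly n m).eval 1 := by
  have hn' : (2 : ℝ) ≤ n := by exact_mod_cast hn
  rw [kernelPoly_eval_one hn]
  have hm : (0 : ℝ) ≤ m := Nat.cast_nonneg m
  exact mul_pos (darbouxConst_pos hn m) (div_pos (by linarith) (by linarith))

theorem gegenbauerMean_kernelPoly (hn : 2 ≤ n) (m : ℕ) :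
    gegenbauerMean n hn (kernelPoly n m) = 1 := by
  induction m with
  | zero => simpa [gegenbauer, kernelPoly] using gegenbauerMean_gegenbauer hn 0
  | succ m ih =>
    rw [kernelPoly, map_add, ih, ← smul_eq_C_mul, map_smul, gegenbauerMean_gegenbauer]
    simp

/-- The reproducing property. By the Christoffel–Darboux formula the kernel times `X - 1` is a
combination of `P_m` and `P_{m+1}`, hence orthogonal to the quotient of `f - f(1)` by `X - 1`. -/
theorem gegenbauerMean_mul_kernelPoly (hn : 2 ≤ n) {f : ℝ[X]} {m : ℕ} (hf : f.natDegree ≤ m) :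
    gegenbauerMean n hn (f * kernelPoly n m) = f.eval 1 := by
  obtain ⟨g, hg⟩ : X - C 1 ∣ f - C (f.eval 1) := by
    rw [dvd_iff_isRoot]; simp
  have hfe : f = C (f.eval 1) + (X - C 1) * g := by rw [← hg]; ring
  have key : f * kernelPoly n m = C (f.eval 1) * kernelPoly n m -
      C (darbouxConst n m) * (g * gegenbauer n m - g * gegenbauer n (m + 1)) := by
    have h := one_sub_X_mul_kernelPoly hn m
    rw [C_1] at hfe
    conv_lhs => rw [hfe]
    linear_combination (-g) * h
  rw [key, map_sub, ← smul_eq_C_mul, ← smul_eq_C_mul, map_smul, map_smul,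
    gegenbauerMean_kernelPoly]
  by_cases hg0 : g = 0
  · simp [hg0]
  have hgd : g.natDegree < m := by
    have h1 : (f - C (f.eval 1)).natDegree ≤ m := by
      rw [natDegree_sub_C]; exact hf
    rw [hg, natDegree_mul (X_sub_C_ne_zero 1) hg0, natDegree_X_sub_C] at h1
    omega
  rw [map_sub, gegenbauerMean_mul_gegenbauer hn hgd,
    gegenbauerMean_mul_gegenbauer hn (hgd.trans (Nat.lt_succ_self m))]
  simp

/-- The Cauchy–Schwarz bound for evaluation at `1`: apply positivity to `g - (g(1)/K(1)) K`. -/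
theorem eval_one_sq_le (hn : 2 ≤ n) {g : ℝ[X]} {m : ℕ} (hg : g.natDegree ≤ m) :
    g.eval 1 ^ 2 ≤ (kernelPoly n m).eval 1 * gegenbauerMean n hn (g * g) := by
  set A := (kernelPoly n m).eval 1 with hA
  have hA0 : 0 < A := kernelPoly_eval_one_pos hn m
  set f := C A * g - C (g.eval 1) * kernelPoly n m with hf
  have hnonneg : 0 ≤ gegenbauerMean n hn (f * f) := by
    by_cases h0 : f = 0
    · simp [h0]
    · exact (gegenbauerMean_mul_self_pos hn h0).le
  have hff : f * f = C (A * A) * (g * g) - C (2 * A * g.eval 1) * (g * kernelPoly n m) +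
      C (g.eval 1 ^ 2) * (kernelPoly n m * kernelPoly n m) := by
    rw [hf]; simp only [C_mul, C_ofNat, C_pow]; ring
  rw [hff, map_add, map_sub, ← smul_eq_C_mul, ← smul_eq_C_mul, ← smul_eq_C_mul, map_smul, map_smul,
    map_smul, gegenbauerMean_mul_kernelPoly hn hg,
    gegenbauerMean_mul_kernelPoly hn (kernelPoly_natDegree_le hn m), ← hA] at hnonneg
  simp only [smul_eq_mul] at hnonneg
  have : 0 ≤ A * (A * gegenbauerMean n hn (g * g) - g.eval 1 ^ 2) := by linarith
  linarith [nonneg_of_mul_nonneg_right this hA0]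

theorem gegenbauer_eval_neg_one (hn : 2 ≤ n) (i : ℕ) :
    (gegenbauer n i).eval (-1) = (-1) ^ i := by
  have hn' : (2 : ℝ) ≤ n := by exact_mod_cast hn
  induction i using Nat.strong_induction_on with
  | _ i ih =>
    match i, ih with
    | 0, _ => simp [gegenbauer]
    | 1, _ => simp [gegenbauer]
    | (i + 2), ih =>
      have hi : (0 : ℝ) ≤ i := Nat.cast_nonneg i
      have hc : ((i : ℝ) + n - 1) ≠ 0 := by linarith
      simp only [gegenbauer, eval_mul, eval_sub, eval_C, eval_X, ih i (by omega),
        ih (i + 1) (by omega)]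
      field_simp
      ring

theorem gegenbauer_not_both_zero (hn : 2 ≤ n) (s : ℝ) (i : ℕ) :
    ¬ ((gegenbauer n i).eval s = 0 ∧ (gegenbauer n (i + 1)).eval s = 0) := by
  induction i with
  | zero => simp [gegenbauer]
  | succ i ih =>
    rintro ⟨h1, h2⟩
    refine ih ⟨?_, h1⟩
    have h := congrArg (eval s) (X_mul_gegenbauer hn i)
    have hn' : (2 : ℝ) ≤ n := by exact_mod_cast hn
    simp only [eval_mul, eval_add, eval_C, eval_X, h1, h2, mul_zero, zero_add] at h
    refine (mul_eq_zero.1 h.symm).resolve_left (div_pos ?_ ?_).ne' <;>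
      linarith [(Nat.cast_nonneg i : (0 : ℝ) ≤ i)]

end Gegenbauer

/-! ### Hermite interpolation from below -/

section Hermite

/-- Rolle's theorem for finitely many zeros: consecutive zeros are separated by zeros of the
derivative, which are therefore new points. -/
theorem exists_finset_derivative_zeros {φ' : ℝ → ℝ} {m : ℕ} (s : Finset ℝ) (hs : s.card = m + 1)
    (hrolle : ∀ x ∈ s, ∀ y ∈ s, x < y → ∃ c ∈ Set.Ioo x y, φ' c = 0) :
    ∃ t : Finset ℝ, t.card = m ∧ Disjoint t s ∧
      ∀ c ∈ t, φ' c = 0 ∧ ∃ x ∈ s, ∃ y ∈ s, c ∈ Set.Ioo x y := by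
  set e := s.orderEmbOfFin hs with he
  have hmem : ∀ i, e i ∈ s := fun i => s.orderEmbOfFin_mem hs i
  choose c hc hc0 using fun i : Fin m => hrolle (e i.castSucc) (hmem _) (e i.succ) (hmem _)
    (e.strictMono (Fin.castSucc_lt_succ))
  have hmono : StrictMono c := fun i j hij =>
    ((hc i).2.trans_le (e.monotone (Fin.succ_le_castSucc_iff.2 hij))).trans (hc j).1
  refine ⟨Finset.univ.image c, ?_, ?_, ?_⟩
  · rw [Finset.card_image_of_injective _ hmono.injective, Finset.card_univ, Fintype.card_fin]
  · rw [Finset.disjoint_left]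
    intro x hx hxs
    obtain ⟨i, -, rfl⟩ := Finset.mem_image.1 hx
    obtain ⟨j, hj⟩ : c i ∈ Set.range e := by rw [he, Finset.range_orderEmbOfFin]; exact hxs
    have h1 := (hc i).1
    have h2 := (hc i).2
    rw [← hj, e.lt_iff_lt] at h1 h2
    rw [Fin.lt_def] at h1 h2
    simp only [Fin.val_castSucc, Fin.val_succ] at h1 h2
    omega
  · intro x hx
    obtain ⟨i, -, rfl⟩ := Finset.mem_image.1 hx
    exact ⟨hc0 i, _, hmem _, _, hmem _, hc i⟩

theorem exists_zero_of_card_zeros {a b : ℝ} (m : ℕ) (F : ℕ → ℝ → ℝ)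
    (hF : ∀ j < m, ∀ x ∈ Set.Ioo a b, HasDerivAt (F j) (F (j + 1) x) x)
    (Z : Finset ℝ) (hZ : Z.card = m + 1) (hZab : ∀ z ∈ Z, z ∈ Set.Ioo a b)
    (hZ0 : ∀ z ∈ Z, F 0 z = 0) : ∃ ξ ∈ Set.Ioo a b, F m ξ = 0 := by
  induction m generalizing F Z with
  | zero =>
    obtain ⟨z, hz⟩ := Finset.card_pos.1 (by omega : 0 < Z.card)
    exact ⟨z, hZab z hz, hZ0 z hz⟩
  | succ m ih =>
    obtain ⟨t, htc, -, ht⟩ := exists_finset_derivative_zeros (φ' := F 1) Z hZ (by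
      intro x hx y hy hxy
      have hsub : ∀ u ∈ Set.Icc x y, u ∈ Set.Ioo a b := fun u hu =>
        ⟨(hZab x hx).1.trans_le hu.1, hu.2.trans_lt (hZab y hy).2⟩
      exact exists_hasDerivAt_eq_zero hxy
        (fun u hu => (hF 0 (by omega) u (hsub u hu)).continuousAt.continuousWithinAt)
        (by rw [hZ0 x hx, hZ0 y hy])
        (fun u hu => hF 0 (by omega) u (hsub u (Set.Ioo_subset_Icc_self hu))))
    refine ih (fun j => F (j + 1)) (fun j hj x hx => hF (j + 1) (by omega) x hx) t htc ?_
      (fun z hz => (ht z hz).1)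
    intro z hz
    obtain ⟨-, x, hx, y, hy, hxy⟩ := ht z hz
    exact ⟨(hZab x hx).1.trans hxy.1, hxy.2.trans (hZab y hy).2⟩

theorem iterate_derivative_natDegree (p : ℝ[X]) (d : ℕ) (hp : p.natDegree ≤ d) :
    derivative^[d] p = C ((d.factorial : ℝ) * p.coeff d) := by
  have h0 : (derivative^[d] p).natDegree ≤ 0 :=
    (natDegree_iterate_derivative p d).trans (by omega)
  rw [eq_C_of_natDegree_le_zero h0, coeff_iterate_derivative]
  simp [Nat.descFactorial_self]

/-- The interpolant with prescribed values on `R` and prescribed derivatives on `B ⊆ R`: correct the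
Lagrange interpolant on `R` by a multiple of the nodal polynomial of `R`. -/
theorem exists_hermite (R B : Finset ℝ) (hBR : B ⊆ R) (v v' : ℝ → ℝ) {d : ℕ}
    (hcard : R.card + B.card = d + 1) :
    ∃ f : ℝ[X], f.natDegree ≤ d ∧ (∀ r ∈ R, f.eval r = v r) ∧
      ∀ b ∈ B, (derivative f).eval b = v' b := by
  have hinj : ∀ s : Finset ℝ, Set.InjOn (id : ℝ → ℝ) s := fun s => Function.injective_id.injOn
  set N := Lagrange.nodal R (id : ℝ → ℝ) with hN
  set L₀ := Lagrange.interpolate R id v with hL₀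
  set L₁ := Lagrange.interpolate B id
    (fun b => (v' b - (derivative L₀).eval b) / (derivative N).eval b) with hL₁
  have h0 : L₀.degree < R.card := Lagrange.degree_interpolate_lt v (hinj R)
  have h1 : L₁.degree < B.card := Lagrange.degree_interpolate_lt _ (hinj B)
  refine ⟨L₀ + N * L₁, natDegree_add_le_of_degree_le ?_ ?_, fun r hr => ?_, fun b hb => ?_⟩
  · by_cases hz : L₀ = 0
    · simp [hz]
    · have := (natDegree_lt_iff_degree_lt hz).2 h0
      omega
  · by_cases hz : L₁ = 0
    · simp [hz]
    · have := (natDegree_lt_iff_degree_lt hz).2 h1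
      have hm := natDegree_mul_le (p := N) (q := L₁)
      rw [hN, Lagrange.natDegree_nodal, ← hN] at hm
      omega
  · have e0 : L₀.eval r = v r := 
      Lagrange.eval_interpolate_at_node v (hinj R) hr
    have e1 : N.eval r = 0 := by simpa using Lagrange.eval_nodal_at_node (v := id) hr
    rw [eval_add, eval_mul, e0, e1, zero_mul, add_zero]
  · have hbR := hBR hb
    have e1 : N.eval b = 0 := by simpa using Lagrange.eval_nodal_at_node (v := id) hbR
    have e2 : (derivative N).eval b ≠ 0 := by
      have := Lagrange.eval_nodal_derivative_eval_node_eq (v := (id : ℝ → ℝ)) hbR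
      rw [id, ← hN] at this
      rw [this]
      exact Lagrange.eval_nodal_not_at_node fun i hi => (Finset.ne_of_mem_erase hi).symm
    have e3 : L₁.eval b = (v' b - (derivative L₀).eval b) / (derivative N).eval b := 
      Lagrange.eval_interpolate_at_node _ (hinj B) hb
    rw [derivative_add, derivative_mul, eval_add, eval_add, eval_mul, eval_mul, e1, e3]
    field_simp
    ring

/-- Hermite interpolation of `h` on `R`, doubly on `B ⊆ R`, stays below `h` when `h^{(d+1)} ≥ 0` and
the nodal polynomial is nonnegative: the error is `h^{(d+1)}(ξ) / (d+1)!` times that polynomial. -/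
theorem exists_hermite_le {a b : ℝ} {h : ℝ → ℝ} {d : ℕ} (R B : Finset ℝ) (hBR : B ⊆ R)
    (hR : ∀ r ∈ R, r ∈ Set.Ico a b) (hB : ∀ r ∈ B, r ∈ Set.Ioo a b)
    (hcard : R.card + B.card = d + 1)
    (hW : ∀ t ∈ Set.Ico a b, 0 ≤ (Lagrange.nodal R id * Lagrange.nodal B id).eval t)
    (hcont : ContinuousOn h (Set.Ico a b))
    (hdiff : ∀ j ≤ d, DifferentiableOn ℝ (iteratedDeriv j h) (Set.Ioo a b))
    (hnonneg : ∀ t ∈ Set.Ioo a b, 0 ≤ iteratedDeriv (d + 1) h t) :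
    ∃ f : ℝ[X], f.natDegree ≤ d ∧ (∀ r ∈ R, f.eval r = h r) ∧
      ∀ t ∈ Set.Ico a b, f.eval t ≤ h t := by
  obtain ⟨f, hfd, hfR, hfB⟩ := exists_hermite R B hBR h (deriv h) hcard
  refine ⟨f, hfd, hfR, fun t ht => ?_⟩
  by_cases htR : t ∈ R
  · exact (hfR t htR).le
  have htB : t ∉ B := fun hh => htR (hBR hh)
  set W : ℝ[X] := Lagrange.nodal R id * Lagrange.nodal B id with hWdef
  have hWt : W.eval t ≠ 0 := by
    rw [hWdef, eval_mul]
    refine mul_ne_zero ?_ ?_ <;> refine Lagrange.eval_nodal_not_at_node fun i hi => ?_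
    · rintro rfl; exact htR hi
    · rintro rfl; exact htB hi
  have hWpos : 0 < W.eval t := lt_of_le_of_ne (hW t ht) hWt.symm
  have hNR : ∀ r ∈ R, (Lagrange.nodal R (id : ℝ → ℝ)).eval r = 0 := fun r hr => by
    simpa using Lagrange.eval_nodal_at_node (v := id) hr
  have hNB : ∀ r ∈ B, (Lagrange.nodal B (id : ℝ → ℝ)).eval r = 0 := fun r hr => by
    simpa using Lagrange.eval_nodal_at_node (v := id) hr
  have hWR : ∀ r ∈ R, W.eval r = 0 := fun r hr => by rw [hWdef, eval_mul, hNR r hr, zero_mul]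
  have hWB : ∀ r ∈ B, (derivative W).eval r = 0 := fun r hr => by
    rw [hWdef, derivative_mul, eval_add, eval_mul, eval_mul, hNR r (hBR hr), hNB r hr]; ring
  have hWmonic : W.Monic := Lagrange.nodal_monic.mul Lagrange.nodal_monic
  have hWdeg : W.natDegree = d + 1 := by
    rw [hWdef, Lagrange.nodal_monic.natDegree_mul Lagrange.nodal_monic, Lagrange.natDegree_nodal,
      Lagrange.natDegree_nodal, hcard]
  -- the multiple of `W` which makes the error vanish at `t` as well
  set c := (h t - f.eval t) / W.eval t with hc
  set p := f + C c * W with hp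
  set F : ℕ → ℝ → ℝ := fun j x => iteratedDeriv j h x - (derivative^[j] p).eval x with hF
  have hFderiv : ∀ j ≤ d, ∀ x ∈ Set.Ioo a b, HasDerivAt (F j) (F (j + 1) x) x := by
    intro j hj x hx
    have h1 := ((hdiff j hj).differentiableAt (isOpen_Ioo.mem_nhds hx)).hasDerivAt
    rw [← iteratedDeriv_succ] at h1
    have h2 := (derivative^[j] p).hasDerivAt x
    rw [← Function.iterate_succ_apply' derivative] at h2
    exact h1.sub h2
  have hFcont : ContinuousOn (F 0) (Set.Ico a b) := by
    simp only [hF, iteratedDeriv_zero]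
    exact hcont.sub (derivative^[0] p).continuous.continuousOn
  have hF0 : ∀ x ∈ insert t R, F 0 x = 0 := by
    intro x hx
    simp only [hF, iteratedDeriv_zero, Function.iterate_zero, id, hp, eval_add, eval_mul, eval_C]
    rcases Finset.mem_insert.1 hx with rfl | hx
    · rw [hc, div_mul_cancel₀ _ hWt]; ring
    · rw [hWR x hx, hfR x hx]; ring
  have hF1 : ∀ x ∈ B, F 1 x = 0 := by
    intro x hx
    simp only [hF, iteratedDeriv_one, Function.iterate_one, hp, derivative_add, derivative_C_mul,
      eval_add, eval_mul, eval_C, hWB x hx, hfB x hx]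
    ring
  have hins : ∀ x ∈ insert t R, x ∈ Set.Ico a b := by
    intro x hx
    rcases Finset.mem_insert.1 hx with rfl | hx
    exacts [ht, hR x hx]
  obtain ⟨Z, hZc, hZd, hZ⟩ := exists_finset_derivative_zeros (φ' := F 1) (insert t R)
    (Finset.card_insert_of_notMem htR) (by
      intro x hx y hy hxy
      have hx' := hins x hx
      have hy' := hins y hy
      exact exists_hasDerivAt_eq_zero hxy
        (hFcont.mono fun u hu => ⟨hx'.1.trans hu.1, hu.2.trans_lt hy'.2⟩)
        (by rw [hF0 x hx, hF0 y hy])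
        (fun u hu => hFderiv 0 (by omega) u ⟨hx'.1.trans_lt hu.1, hu.2.trans hy'.2⟩))
  have hZB : Disjoint Z B := Finset.disjoint_of_subset_right
    (hBR.trans (Finset.subset_insert t R)) hZd
  obtain ⟨ξ, hξ, hξ0⟩ := exists_zero_of_card_zeros (a := a) (b := b) d (fun j => F (j + 1))
    (fun j hj x hx => hFderiv (j + 1) (by omega) x hx) (Z ∪ B)
    (by rw [Finset.card_union_of_disjoint hZB, hZc, hcard])
    (by
      intro z hz
      rcases Finset.mem_union.1 hz with hz | hz
      · obtain ⟨-, x, hx, y, hy, hxy⟩ := hZ z hz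
        exact ⟨(hins x hx).1.trans_lt hxy.1, hxy.2.trans (hins y hy).2⟩
      · exact hB z hz)
    (by
      intro z hz
      rcases Finset.mem_union.1 hz with hz | hz
      exacts [(hZ z hz).1, hF1 z hz])
  have hpd : derivative^[d + 1] p = C (((d + 1).factorial : ℝ) * c) := by
    have hpdeg : p.natDegree ≤ d + 1 :=
      natDegree_add_le_of_degree_le (by omega) ((natDegree_C_mul_le _ _).trans hWdeg.le)
    rw [iterate_derivative_natDegree p (d + 1) hpdeg, hp, coeff_add, coeff_C_mul,
      coeff_eq_zero_of_natDegree_lt (by omega : f.natDegree < d + 1)]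
    have : W.coeff (d + 1) = 1 := by rw [← hWdeg]; exact hWmonic
    rw [this]; simp
  simp only [hF, hpd, eval_C] at hξ0
  have hfac : (0 : ℝ) < (d + 1).factorial := by exact_mod_cast Nat.factorial_pos _
  have hc0 : 0 ≤ c := by
    have := hnonneg ξ hξ
    have h2 : 0 ≤ ((d + 1).factorial : ℝ) * c := by linarith
    exact nonneg_of_mul_nonneg_right h2 hfac
  have : 0 ≤ h t - f.eval t := by
    have := mul_nonneg hc0 hWpos.le
    rwa [hc, div_mul_cancel₀ _ hWt] at this
  linarith

end Hermite

/-! ### The energy of a design as a positive functional -/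

namespace WeightedSphericalCode

variable {n N : ℕ} (CW : WeightedSphericalCode n N)

theorem inner_mem_Ico {i j : Fin N} (hij : i ≠ j) :
    inner ℝ (CW.point i) (CW.point j) ∈ Set.Ico (-1 : ℝ) 1 := by
  refine ⟨?_, ?_⟩
  · have := abs_real_inner_le_norm (CW.point i) (CW.point j)
    rw [CW.norm_point, CW.norm_point, mul_one] at this
    exact (abs_le.1 this).1
  · exact inner_lt_one_iff_real_of_norm_eq_one (CW.norm_point i) (CW.norm_point j) |>.2
      (CW.injective_point.ne hij)

theorem energy_mono {F G : ℝ → ℝ} (hFG : ∀ t ∈ Set.Ico (-1 : ℝ) 1, F t ≤ G t) :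
    CW.energy F ≤ CW.energy G := by
  refine Finset.sum_le_sum fun i _ => Finset.sum_le_sum fun j hj => ?_
  exact mul_le_mul_of_nonneg_left (hFG _ (CW.inner_mem_Ico (Finset.ne_of_mem_erase hj).symm))
    (mul_pos (CW.weight_pos i) (CW.weight_pos j)).le

theorem energy_nonneg {F : ℝ → ℝ} (hF : ∀ t ∈ Set.Ico (-1 : ℝ) 1, 0 ≤ F t) :
    0 ≤ CW.energy F := by
  simpa [energy] using CW.energy_mono hF

theorem eq_zero_of_energy_eq_zero {F : ℝ → ℝ} (hF : ∀ t ∈ Set.Ico (-1 : ℝ) 1, 0 ≤ F t)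
    (h0 : CW.energy F = 0) {i j : Fin N} (hij : i ≠ j) :
    F (inner ℝ (CW.point i) (CW.point j)) = 0 := by
  have hterm : ∀ i, ∀ j ∈ Finset.univ.erase i,
      0 ≤ CW.weight i * CW.weight j * F (inner ℝ (CW.point i) (CW.point j)) := fun i j hj =>
    mul_nonneg (mul_pos (CW.weight_pos i) (CW.weight_pos j)).le
      (hF _ (CW.inner_mem_Ico (Finset.ne_of_mem_erase hj).symm))
  have h1 := (Finset.sum_eq_zero_iff_of_nonneg
    (fun i _ => Finset.sum_nonneg (hterm i))).1 h0 i (Finset.mem_univ i)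
  have h2 := (Finset.sum_eq_zero_iff_of_nonneg (hterm i)).1 h1 j
    (Finset.mem_erase.2 ⟨hij.symm, Finset.mem_univ j⟩)
  exact (mul_eq_zero.1 h2).resolve_left (mul_pos (CW.weight_pos i) (CW.weight_pos j)).ne'

theorem sum_weight_sq : ∑ i, CW.weight i ^ 2 = 1 / CW.effectiveSize := by
  rw [effectiveSize, one_div_one_div]

variable {CW}

theorem IsDesign.sum_eq_gegenbauerMean {τ : ℕ} (hd : CW.IsDesign τ) (hn : 2 ≤ n) {f : ℝ[X]}
    (hf : f.natDegree ≤ τ) :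
    ∑ i, ∑ j, CW.weight i * CW.weight j * f.eval (inner ℝ (CW.point i) (CW.point j)) =
      gegenbauerMean n hn f := by
  set Φ : ℝ[X] →ₗ[ℝ] ℝ := ∑ i, ∑ j,
    (CW.weight i * CW.weight j) • leval (inner ℝ (CW.point i) (CW.point j)) with hΦ
  have hΦa : ∀ p : ℝ[X], Φ p =
      ∑ i, ∑ j, CW.weight i * CW.weight j * p.eval (inner ℝ (CW.point i) (CW.point j)) := by
    intro p
    simp [hΦ, LinearMap.sum_apply, leval]
  have hmem : f ∈ LinearMap.eqLocus Φ (gegenbauerMean n hn) := by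
    refine gegenbauer_mem_of_natDegree_le hn _ (fun l hl => ?_) hf
    rw [LinearMap.mem_eqLocus, gegenbauerMean_gegenbauer, hΦa]
    by_cases h0 : l = 0
    · subst h0
      simp [gegenbauer, ← Finset.mul_sum, CW.weight_sum]
    · rw [if_neg h0]
      exact hd l (Nat.one_le_iff_ne_zero.2 h0) hl
  rw [← hΦa]
  exact hmem

/-- On polynomials of degree at most `τ` the energy of a `τ`-design is `f_0 - f(1) / N_W`. -/
theorem IsDesign.energy_eval {τ : ℕ} (hd : CW.IsDesign τ) (hn : 2 ≤ n) {f : ℝ[X]}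
    (hf : f.natDegree ≤ τ) :
    CW.energy (fun t => f.eval t) = gegenbauerMean n hn f - f.eval 1 / CW.effectiveSize := by
  rw [← hd.sum_eq_gegenbauerMean hn hf, energy, div_eq_mul_one_div, ← CW.sum_weight_sq,
    Finset.mul_sum, ← Finset.sum_sub_distrib]
  refine Finset.sum_congr rfl fun i _ => ?_
  rw [Finset.sum_erase_eq_sub (Finset.mem_univ i), real_inner_self_eq_norm_sq, CW.norm_point]
  simp only [one_pow]
  ring

/-- The inner products of a design with large effective size are not the zeros of a polynomial of
small degree: for such `g` the energy of `g²` is `(g²)_0 - g(1)²/N_W`, which is positive because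
`g(1)² ≤ K_m(1) (g²)_0`. -/
theorem IsDesign.eq_zero_of_eval_inner {τ m : ℕ} (hd : CW.IsDesign τ) (hn : 2 ≤ n)
    (hmτ : 2 * m ≤ τ) (hM : (kernelPoly n m).eval 1 < CW.effectiveSize) {g : ℝ[X]}
    (hg : g.natDegree ≤ m)
    (h0 : ∀ i j, i ≠ j → g.eval (inner ℝ (CW.point i) (CW.point j)) = 0) : g = 0 := by
  by_contra hg0
  have hM0 : 0 < CW.effectiveSize := (kernelPoly_eval_one_pos hn m).trans hM
  have hpos := gegenbauerMean_mul_self_pos hn hg0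
  have hle := eval_one_sq_le hn hg
  have hE := hd.energy_eval hn (f := g * g) (natDegree_mul_le.trans (by omega))
  have hE0 : CW.energy (fun t => (g * g).eval t) = 0 :=
    Finset.sum_eq_zero fun i _ => Finset.sum_eq_zero fun j hj => by
      simp [h0 i j (Finset.ne_of_mem_erase hj).symm]
  rw [hE0, eval_mul, eq_comm, sub_eq_zero, eq_div_iff hM0.ne'] at hE
  nlinarith

end WeightedSphericalCode

/-! ### The node polynomial -/

section NodePoly

variable {n : ℕ}

/-- The polynomial `(1 + t)^ε K_m(t) + (M - K_m(1)) (ε P_k(t) + P_{k+ε}(t))`, `m = k - 1 + ε`, whose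
zeros are the nodes; it is what remains of the equation `L = M` after clearing denominators and
cancelling `1 - t`. -/
def nodePoly (n k ε : ℕ) (M : ℝ) : ℝ[X] :=
  (1 + X) ^ ε * kernelPoly n (k - 1 + ε) +
    C (M - (kernelPoly n (k - 1 + ε)).eval 1) *
      (C (ε : ℝ) * gegenbauer n k + gegenbauer n (k + ε))

theorem two_mul_choose_eq (hn : 2 ≤ n) (m : ℕ) :
    2 * ((n + m - 1).choose (n - 1) : ℝ) = (kernelPoly n m).eval 1 + darbouxConst n m := by
  obtain ⟨p, rfl⟩ : ∃ p, n = p + 2 := ⟨n - 2, by omega⟩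
  have h := Nat.add_one_mul_choose_eq (m + p) p
  have e1 : p + 2 + m - 1 = m + p + 1 := by omega
  have e2 : p + 2 - 1 = p + 1 := by omega
  have e3 : m + (p + 2) - 2 = m + p := by omega
  have h' : ((m : ℝ) + p + 1) * (m + p).choose p = (m + p + 1).choose (p + 1) * (p + 1) := by
    exact_mod_cast h
  have hp : (p : ℝ) + 1 ≠ 0 := by positivity
  rw [kernelPoly_eval_one hn, e1, e2, darbouxConst, e3, Nat.add_sub_cancel]
  push_cast
  have hp' : (p : ℝ) + 2 - 1 ≠ 0 := fun h0 => hp (by linarith)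
  field_simp
  linear_combination (-2) * h'

theorem dgsBound_odd (hn : 2 ≤ n) (m : ℕ) :
    (dgsBound n (2 * m + 1) : ℝ) = (kernelPoly n m).eval 1 + darbouxConst n m := by
  rw [← two_mul_choose_eq hn, dgsBound]
  have e1 : (2 * m + 1 + 1) / 2 = m + 1 := by omega
  have e2 : (2 * m + 1 + 1) % 2 = 0 := by omega
  have e3 : n + (m + 1) - 2 = n + m - 1 := by omega
  rw [e1, e2, e3, add_zero, Nat.cast_add, two_mul]

theorem dgsBound_even (hn : 2 ≤ n) (m : ℕ) :
    (dgsBound n (2 * m) : ℝ) = (kernelPoly n m).eval 1 := by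
  have h := two_mul_choose_eq hn m
  obtain ⟨p, rfl⟩ : ∃ p, n = p + 2 := ⟨n - 2, by omega⟩
  rw [dgsBound]
  have e1 : (2 * m + 1) / 2 = m := by omega
  have e2 : (2 * m + 1) % 2 = 1 := by omega
  have e3 : p + 2 + m - 2 + 1 = m + p + 1 := by omega
  have e4 : p + 2 + m - 2 = m + p := by omega
  have e5 : p + 2 - 1 = p + 1 := by omega
  have e6 : p + 2 + m - 1 = m + p + 1 := by omega
  have e7 : m + (p + 2) - 2 = m + p := by omega
  rw [e6, e5, darbouxConst, e7, Nat.add_sub_cancel] at h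
  rw [e1, e2, e3, e4, e5]
  have hp : ((m + p + 1).choose (p + 1) : ℝ) = (m + p).choose p + (m + p).choose (p + 1) := by
    exact_mod_cast Nat.choose_succ_succ (m + p) p
  push_cast
  linarith

theorem kernelPoly_eval_one_le_dgsBound (hn : 2 ≤ n) {k ε : ℕ} (hk : 1 ≤ k) (hε : ε ≤ 1) :
    (kernelPoly n (k - 1 + ε)).eval 1 ≤ (dgsBound n (2 * k - 1 + ε) : ℝ) := by
  obtain ⟨k, rfl⟩ : ∃ l, k = l + 1 := ⟨k - 1, by omega⟩
  interval_cases ε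
  · have e : 2 * (k + 1) - 1 + 0 = 2 * k + 1 := by omega
    rw [e, dgsBound_odd hn]
    simpa using (darbouxConst_pos hn k).le
  · have e : 2 * (k + 1) - 1 + 1 = 2 * (k + 1) := by omega
    rw [e, dgsBound_even hn, Nat.add_sub_cancel]

theorem natDegree_one_add_X_pow_le (ε : ℕ) : ((1 + X : ℝ[X]) ^ ε).natDegree ≤ ε := by
  refine natDegree_pow_le.trans_eq ?_
  rw [add_comm, ← C_1, natDegree_X_add_C, mul_one]

theorem nodePoly_natDegree_le (hn : 2 ≤ n) {k ε : ℕ} (hk : 1 ≤ k) (hε : ε ≤ 1) (M : ℝ) :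
    (nodePoly n k ε M).natDegree ≤ k + ε := by
  refine natDegree_add_le_of_degree_le ?_ ((natDegree_C_mul_le _ _).trans
    (natDegree_add_le_of_degree_le ?_ (gegenbauer_natDegree hn _).le))
  · refine (natDegree_mul_le_of_le (m := ε) ?_ (kernelPoly_natDegree_le hn _)).trans (by omega)
    exact natDegree_one_add_X_pow_le ε
  · exact (natDegree_C_mul_le _ _).trans ((gegenbauer_natDegree hn _).le.trans (by omega))

theorem nodePoly_eval_one (hn : 2 ≤ n) {k ε : ℕ} (hε : ε ≤ 1) (M : ℝ) :
    (nodePoly n k ε M).eval 1 = 2 ^ ε * M := by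
  simp only [nodePoly, eval_add, eval_mul, eval_pow, eval_one, eval_X, eval_C,
    gegenbauer_one n hn]
  interval_cases ε
  · rw [Nat.cast_zero]; ring
  · rw [Nat.cast_one]; ring

/-- The node polynomial is orthogonal, for the functional `f ↦ f_0 - f(1) / M`, to the polynomials
of degree less than `k`. -/
theorem gegenbauerMean_nodePoly_mul (hn : 2 ≤ n) {k ε : ℕ} (hk : 1 ≤ k) (hε : ε ≤ 1) (M : ℝ)
    {f : ℝ[X]} (hf : f.natDegree ≤ k - 1) :
    gegenbauerMean n hn (nodePoly n k ε M * f) = 2 ^ ε * f.eval 1 := by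
  have e : nodePoly n k ε M * f = ((1 + X) ^ ε * f) * kernelPoly n (k - 1 + ε) +
      C (M - (kernelPoly n (k - 1 + ε)).eval 1) *
        (C (ε : ℝ) * (f * gegenbauer n k) + f * gegenbauer n (k + ε)) := by
    rw [nodePoly]; ring
  have hdeg : ((1 + X) ^ ε * f).natDegree ≤ k - 1 + ε := by
    refine (natDegree_mul_le_of_le (m := ε) ?_ hf).trans (by omega)
    exact natDegree_one_add_X_pow_le ε
  rw [e, map_add, gegenbauerMean_mul_kernelPoly hn hdeg, ← smul_eq_C_mul, map_smul, map_add,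
    ← smul_eq_C_mul, map_smul, gegenbauerMean_mul_gegenbauer hn (j := k) (by omega),
    gegenbauerMean_mul_gegenbauer hn (j := k + ε) (by omega)]
  simp only [eval_mul, eval_pow, eval_add, eval_one, eval_X, smul_eq_mul, mul_zero, add_zero]
  norm_num

theorem nodePoly_eval_neg_one (hn : 2 ≤ n) {k : ℕ} (M : ℝ) :
    (nodePoly n k 1 M).eval (-1) = 0 := by
  simp [nodePoly, gegenbauer_eval_neg_one hn, pow_succ]

/-- For `ε = 0` the strict inequality `D(n,τ) < M` excludes `-1` as a node: the value there is a
multiple of `D(n,τ) - M`. -/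
theorem nodePoly_eval_neg_one_ne_zero (hn : 2 ≤ n) {k : ℕ} (hk : 1 ≤ k) {M : ℝ}
    (hM : (dgsBound n (2 * k - 1) : ℝ) < M) : (nodePoly n k 0 M).eval (-1) ≠ 0 := by
  obtain ⟨k, rfl⟩ : ∃ l, k = l + 1 := ⟨k - 1, by omega⟩
  have e : 2 * (k + 1) - 1 = 2 * k + 1 := by omega
  rw [e, dgsBound_odd hn] at hM
  have hCD := congrArg (eval (-1)) (one_sub_X_mul_kernelPoly hn k)
  simp only [eval_mul, eval_sub, eval_one, eval_X, eval_C, gegenbauer_eval_neg_one hn] at hCD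
  have hK : (kernelPoly n k).eval (-1) = darbouxConst n k * (-1) ^ k := by
    rw [pow_succ] at hCD; linarith
  have : (nodePoly n (k + 1) 0 M).eval (-1) =
      (-1) ^ k * (darbouxConst n k + (kernelPoly n k).eval 1 - M) := by
    simp only [nodePoly, eval_add, eval_mul, eval_C, gegenbauer_eval_neg_one hn, pow_zero, one_mul,
      Nat.add_sub_cancel, add_zero, hK, Nat.cast_zero, zero_mul, zero_add]
    rw [pow_succ]; ring
  rw [this]
  exact mul_ne_zero (pow_ne_zero _ (by norm_num)) (by linarith)

/-- The nodes are the zeros of the node polynomial: the Christoffel–Darboux formula turns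
`P_m - P_{m+1}` into a multiple of `(1 - s) K_m(s)`. A zero of the node polynomial at which the
denominator of `L` vanished would, apart from `s = -1`, be a common zero of `P_m` and `P_{m+1}`. -/
theorem levenshteinNodes_eq (hn : 2 ≤ n) {k ε : ℕ} (hk : 1 ≤ k) (hε : ε ≤ 1) {M : ℝ}
    (hM : (kernelPoly n (k - 1 + ε)).eval 1 < M) :
    levenshteinNodes n k ε M = {s | (nodePoly n k ε M).eval s = 0} := by
  have hn' : (2 : ℝ) ≤ n := by exact_mod_cast hn
  have hM0 : 0 < M := (kernelPoly_eval_one_pos hn _).trans hM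
  set m := k - 1 + ε with hm
  have hkm : k + ε = m + 1 := by omega
  have hconst : ((k + n - 3 + ε).choose (n - 2) : ℝ) = darbouxConst n m := by
    rw [darbouxConst, show k + n - 3 + ε = m + n - 2 by omega]
  have hfrac : 2 * (k : ℝ) + n - 3 + 2 * ε = 2 * m + n - 1 := by
    have : (k : ℝ) + ε = m + 1 := by exact_mod_cast hkm
    linarith
  have hL : ∀ s, levenshteinDenom n k ε s ≠ 0 →
      (levenshteinL n k ε s = M ↔ (nodePoly n k ε M).eval s = 0) := by
    intro s hs
    have hCD := congrArg (eval s) (one_sub_X_mul_kernelPoly hn m)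
    simp only [eval_mul, eval_sub, eval_one, eval_X, eval_C] at hCD
    have h1 : levenshteinL n k ε s = (kernelPoly n m).eval 1 -
        (1 + s) ^ ε * ((1 - s) * (kernelPoly n m).eval s) / levenshteinDenom n k ε s := by
      rw [levenshteinL, hconst, hfrac, ← hm, hkm, hCD, kernelPoly_eval_one hn]
      ring
    have h2 : (nodePoly n k ε M).eval s * (1 - s) =
        (1 + s) ^ ε * ((1 - s) * (kernelPoly n m).eval s) +
          (M - (kernelPoly n m).eval 1) * levenshteinDenom n k ε s := by
      simp only [nodePoly, levenshteinDenom, ← hm, eval_add, eval_mul, eval_pow, eval_one, eval_X,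
        eval_C]
      ring
    have hs1 : 1 - s ≠ 0 := left_ne_zero_of_mul hs
    rw [h1, sub_eq_iff_eq_add, ← sub_eq_iff_eq_add', eq_div_iff hs]
    constructor
    · intro h
      refine (mul_eq_zero.1 (?_ : _ * (1 - s) = 0)).resolve_right hs1
      rw [h2, ← h]; ring
    · intro h
      rw [h, zero_mul] at h2
      linarith
  ext s
  simp only [levenshteinNodes, Set.mem_union, Set.mem_ofPred_eq]
  constructor
  · rintro (⟨hs, h⟩ | ⟨rfl, rfl⟩)
    · exact (hL s hs).1 h
    · exact nodePoly_eval_neg_one hn M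
  · intro hs
    by_cases hden : levenshteinDenom n k ε s = 0
    swap
    · exact Or.inl ⟨hden, (hL s hden).2 hs⟩
    right
    have hs1 : s ≠ 1 := by
      rintro rfl
      rw [nodePoly_eval_one hn hε] at hs
      exact (mul_pos (by positivity) hM0).ne' hs
    have hs1' : 1 - s ≠ 0 := sub_ne_zero.2 hs1.symm
    have hE := (mul_eq_zero.1 hden).resolve_left hs1'
    have hQ : (1 + s) ^ ε * (kernelPoly n m).eval s = 0 := by
      simp only [nodePoly, ← hm, eval_add, eval_mul, eval_pow, eval_one, eval_X, eval_C] at hs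
      rw [hE, mul_zero, add_zero] at hs
      exact hs
    rcases mul_eq_zero.1 hQ with h | h
    · have hε0 : ε ≠ 0 := by rintro rfl; simp at h
      exact ⟨by omega, by linarith [eq_zero_of_pow_eq_zero h]⟩
    · exfalso
      have hCD := congrArg (eval s) (one_sub_X_mul_kernelPoly hn m)
      simp only [eval_mul, eval_sub, eval_one, eval_X, eval_C, h, mul_zero] at hCD
      have hPP := (mul_eq_zero.1 hCD.symm).resolve_left (darbouxConst_pos hn m).ne'
      refine gegenbauer_not_both_zero hn s m ?_
      rw [hkm] at hE
      interval_cases ε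
      · simp only [Nat.cast_zero, zero_mul, zero_add] at hE
        exact ⟨by linarith, hE⟩
      · have hk' : k = m := by omega
        rw [hk', Nat.cast_one, one_mul] at hE
        exact ⟨by linarith, by linarith⟩

end NodePoly

/-! ### Location of the nodes -/

section Location

variable {n N : ℕ} {CW : WeightedSphericalCode n N}

theorem WeightedSphericalCode.IsDesign.energy_nodePoly_mul {k ε : ℕ}
    (hd : CW.IsDesign (2 * k - 1 + ε)) (hn : 2 ≤ n) (hk : 1 ≤ k) (hε : ε ≤ 1)
    (hM : 0 < CW.effectiveSize) {f : ℝ[X]} (hf : f.natDegree ≤ k - 1) :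
    CW.energy (fun t => (nodePoly n k ε CW.effectiveSize * f).eval t) = 0 := by
  rw [hd.energy_eval hn ((natDegree_mul_le_of_le (nodePoly_natDegree_le hn hk hε _) hf).trans
    (by omega)), gegenbauerMean_nodePoly_mul hn hk hε _ hf, eval_mul, nodePoly_eval_one hn hε]
  field_simp
  ring

/-- The cofactor `p` of `(1 + t)^ε` in the node polynomial has no factorization `p = u g` with `u`
nonnegative on `[-1,1)` and with `(1 + t)^ε v` vanishing at the zeros of `u` there, where
`deg v + deg g < k`. Orthogonality makes the energy of `(1 + t)^ε u g²` zero, so `(1 + t)^ε v g`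
vanishes at all inner products although its degree is too small for that. -/
theorem WeightedSphericalCode.IsDesign.not_nodePoly_factor {k ε : ℕ}
    (hd : CW.IsDesign (2 * k - 1 + ε)) (hn : 2 ≤ n) (hk : 1 ≤ k) (hε : ε ≤ 1)
    (hM : (kernelPoly n (k - 1 + ε)).eval 1 < CW.effectiveSize) {u v g : ℝ[X]}
    (hq : nodePoly n k ε CW.effectiveSize = (1 + X) ^ ε * (u * g)) (hv0 : v ≠ 0) (hg0 : g ≠ 0)
    (hdeg : v.natDegree + g.natDegree ≤ k - 1)
    (hu : ∀ t ∈ Set.Ico (-1 : ℝ) 1, 0 ≤ u.eval t)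
    (huv : ∀ t ∈ Set.Ico (-1 : ℝ) 1, u.eval t = 0 → (1 + t) ^ ε * v.eval t = 0) : False := by
  have hM0 : 0 < CW.effectiveSize := (kernelPoly_eval_one_pos hn _).trans hM
  have hE := hd.energy_nodePoly_mul hn hk hε hM0 (f := g) (by omega)
  have heval : ∀ t, (nodePoly n k ε CW.effectiveSize * g).eval t =
      (1 + t) ^ ε * (u.eval t * (g.eval t * g.eval t)) := by
    intro t
    rw [hq]
    simp only [eval_mul, eval_pow, eval_add, eval_one, eval_X]
    ring
  have hX : (1 + X : ℝ[X]) ≠ 0 := by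
    intro h
    have := congrArg (eval 0) h
    simp at this
  have hzero := hd.eq_zero_of_eval_inner hn (m := k - 1 + ε) (by omega) hM
    (g := (1 + X) ^ ε * (v * g)) (by
      exact (natDegree_mul_le_of_le (natDegree_one_add_X_pow_le ε) natDegree_mul_le).trans
        (by omega))
    (by
      intro i j hij
      have hmem := CW.inner_mem_Ico hij
      have h0 := CW.eq_zero_of_energy_eq_zero (F := fun t =>
        (nodePoly n k ε CW.effectiveSize * g).eval t) (fun t ht => by
          have h1 : 0 ≤ 1 + t := by linarith [ht.1]
          have h2 := hu t ht
          have h3 := mul_self_nonneg (g.eval t)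
          simp only [heval]
          positivity) hE hij
      set t : ℝ := inner ℝ (CW.point i) (CW.point j) with ht
      simp only [heval] at h0
      simp only [eval_mul, eval_pow, eval_add, eval_one, eval_X]
      rcases mul_eq_zero.1 h0 with h | h
      · rw [h, zero_mul]
      · rcases mul_eq_zero.1 h with h | h
        · rw [← mul_assoc, huv t hmem h, zero_mul]
        · rw [mul_self_eq_zero.1 h, mul_zero, mul_zero])
  exact mul_ne_zero (pow_ne_zero _ hX) (mul_ne_zero hv0 hg0) hzero

/-- The node polynomial has `k` simple zeros in `(-1,1)`, and `-1` as a further zero if `ε = 1`: `R`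
is the set of all zeros and `B` the set of those in `(-1,1)`. -/
theorem WeightedSphericalCode.IsDesign.exists_nodes {k ε : ℕ}
    (hd : CW.IsDesign (2 * k - 1 + ε)) (hn : 2 ≤ n) (hk : 1 ≤ k) (hε : ε ≤ 1)
    (hlower : (dgsBound n (2 * k - 1 + ε) : ℝ) < CW.effectiveSize) :
    ∃ (R B : Finset ℝ) (c : ℝ), B ⊆ R ∧ (∀ r ∈ R, r ∈ Set.Ico (-1 : ℝ) 1) ∧
      (∀ b ∈ B, b ∈ Set.Ioo (-1 : ℝ) 1) ∧ R.card = k + ε ∧ B.card = k ∧ c ≠ 0 ∧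
      nodePoly n k ε CW.effectiveSize = C c * Lagrange.nodal R id ∧
      ∀ t ∈ Set.Ico (-1 : ℝ) 1, 0 ≤ (Lagrange.nodal R id * Lagrange.nodal B id).eval t := by
  have hM := (kernelPoly_eval_one_le_dgsBound hn hk hε).trans_lt hlower
  have hM0 : 0 < CW.effectiveSize := (kernelPoly_eval_one_pos hn _).trans hM
  set q := nodePoly n k ε CW.effectiveSize with hqdef
  have hq0 : q ≠ 0 := by
    intro h
    have h1 := nodePoly_eval_one hn (k := k) hε CW.effectiveSize
    rw [← hqdef, h, eval_zero] at h1
    exact (mul_pos (by positivity) hM0).ne h1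
  obtain ⟨p, hp⟩ : ∃ p, q = (1 + X) ^ ε * p := by
    rcases Nat.le_one_iff_eq_zero_or_eq_one.1 hε with rfl | rfl
    · exact ⟨q, by rw [pow_zero, one_mul]⟩
    · have h1 : (1 + X : ℝ[X]) = X - C (-1) := by rw [C_neg, C_1]; ring
      rw [pow_one, h1]
      exact dvd_iff_isRoot.2 (nodePoly_eval_neg_one hn _)
  have hp0 : p ≠ 0 := by rintro rfl; simp [hp] at hq0
  have hXmonic : (1 + X : ℝ[X]).Monic := by rw [add_comm, ← C_1]; exact monic_X_add_C 1
  have hXdeg : (1 + X : ℝ[X]).natDegree = 1 := by rw [add_comm, ← C_1, natDegree_X_add_C]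
  have hpk : p.natDegree ≤ k := by
    have h1 := nodePoly_natDegree_le hn hk hε CW.effectiveSize
    rw [← hqdef, hp, (hXmonic.pow ε).natDegree_mul' hp0, hXmonic.natDegree_pow, hXdeg] at h1
    omega
  -- no factorization with a factor of constant sign
  have hbad : ∀ u v g : ℝ[X], p = u * g → v ≠ 0 → v.natDegree < u.natDegree →
      ((∀ t ∈ Set.Ico (-1 : ℝ) 1, 0 ≤ u.eval t) ∨ ∀ t ∈ Set.Ico (-1 : ℝ) 1, u.eval t ≤ 0) →
      (∀ t ∈ Set.Ico (-1 : ℝ) 1, u.eval t = 0 → (1 + t) ^ ε * v.eval t = 0) → False := by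
    intro u v g hpu hv0 hvu hsign huv
    have hu0 : u ≠ 0 := by rintro rfl; simp [hpu] at hp0
    have hg0 : g ≠ 0 := by rintro rfl; simp [hpu] at hp0
    have hdeg : v.natDegree + g.natDegree ≤ k - 1 := by
      rw [hpu, natDegree_mul hu0 hg0] at hpk
      omega
    rcases hsign with hs | hs
    · exact hd.not_nodePoly_factor hn hk hε hM (u := u) (v := v) (g := g) (by rw [← hpu]; exact hp)
        hv0 hg0 hdeg hs huv
    · exact hd.not_nodePoly_factor hn hk hε hM (u := -u) (v := v) (g := -g)
        (by rw [neg_mul_neg, ← hpu]; exact hp) hv0 (neg_ne_zero.2 hg0) (by rwa [natDegree_neg])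
        (fun t ht => by rw [eval_neg]; linarith [hs t ht])
        (fun t ht h => huv t ht (by rw [eval_neg] at h; linarith))
  have hpdeg : p.natDegree = k := by
    by_contra hne
    exact hd.not_nodePoly_factor hn hk hε hM (u := 1) (v := 1) (g := p)
      (by rw [one_mul]; exact hp) one_ne_zero hp0 (by rw [natDegree_one]; omega)
      (fun t _ => by simp) (fun t _ h => by simp at h)
  have hcard : Multiset.card p.roots = p.natDegree := by
    obtain ⟨g, hg, hgc, hgr⟩ := exists_prod_multiset_X_sub_C_mul p
    by_contra hne
    have hg0 : g ≠ 0 := by rintro rfl; simp at hg; exact hp0 hg.symm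
    have hgroot : ∀ t, g.eval t ≠ 0 := fun t ht => by
      have := (mem_roots hg0).2 ht
      simp [hgr] at this
    refine hbad g 1 _ (by rw [mul_comm]; exact hg.symm) one_ne_zero (by rw [natDegree_one]; omega)
      ?_ (fun t _ h => absurd h (hgroot t))
    -- a real polynomial without zeros has constant sign
    by_contra hcon
    push Not at hcon
    obtain ⟨⟨a, -, ha⟩, ⟨b, -, hb⟩⟩ := hcon
    obtain ⟨x, -, hx⟩ := isPreconnected_univ.intermediate_value (Set.mem_univ a) (Set.mem_univ b)
      g.continuous.continuousOn ⟨ha.le, hb.le⟩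
    exact hgroot x hx
  have hnodup : p.roots.Nodup := by
    rw [Multiset.nodup_iff_count_le_one]
    intro a
    by_contra hcount
    rw [count_roots, not_le] at hcount
    obtain ⟨g, hg⟩ := (le_rootMultiplicity_iff hp0).1 (Nat.succ_le_of_lt hcount)
    refine hbad ((X - C a) ^ 2) (X - C a) g hg (X_sub_C_ne_zero a) (by simp)
      (Or.inl fun t _ => by simp only [eval_pow]; positivity) (fun t _ h => ?_)
    rw [eval_pow] at h
    rw [eq_zero_of_pow_eq_zero h, mul_zero]
  have hroots : ∀ a ∈ p.roots, a ∈ Set.Ioo (-1 : ℝ) 1 := by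
    intro a ha
    have har : p.eval a = 0 := (mem_roots hp0).1 ha
    obtain ⟨g, hg⟩ := dvd_iff_isRoot.2 (show p.IsRoot a from har)
    by_contra hnot
    have hcases : a < -1 ∨ a = -1 ∨ 1 ≤ a := by
      rcases lt_trichotomy a (-1) with h | h | h
      · exact Or.inl h
      · exact Or.inr (Or.inl h)
      · exact Or.inr (Or.inr (not_lt.1 fun h' => hnot ⟨h, h'⟩))
    refine hbad (X - C a) 1 g hg one_ne_zero (by simp) ?_ ?_
    · rcases hcases with h | h | h
      · exact Or.inl fun t ht => by simp; linarith [ht.1]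
      · exact Or.inl fun t ht => by simp; linarith [ht.1]
      · exact Or.inr fun t ht => by simp; linarith [ht.2]
    · intro t ht h
      have hta : t = a := by simpa [sub_eq_zero] using h
      rcases hcases with h | h | h
      · linarith [ht.1]
      · rcases Nat.le_one_iff_eq_zero_or_eq_one.1 hε with rfl | rfl
        · exfalso
          refine nodePoly_eval_neg_one_ne_zero hn hk hlower ?_
          rw [← hqdef, hp, pow_zero, one_mul, ← h, har]
        · rw [hta, h]; simp
      · linarith [ht.2]
  set B := p.roots.toFinset with hBdef
  have hBcard : B.card = k := by
    rw [hBdef, Multiset.toFinset_card_of_nodup hnodup, hcard, hpdeg]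
  have hB : ∀ b ∈ B, b ∈ Set.Ioo (-1 : ℝ) 1 := fun b hb => hroots b (Multiset.mem_toFinset.1 hb)
  have hpB : p = C p.leadingCoeff * Lagrange.nodal B id := by
    conv_lhs => rw [← C_leadingCoeff_mul_prod_multiset_X_sub_C hcard]
    rw [Lagrange.nodal_eq, Finset.prod, hBdef, Multiset.toFinset_val, hnodup.dedup]
    rfl
  have hlc : p.leadingCoeff ≠ 0 := leadingCoeff_ne_zero.2 hp0
  have hsign : ∀ R : Finset ℝ, Lagrange.nodal R id = (1 + X) ^ ε * Lagrange.nodal B id →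
      ∀ t ∈ Set.Ico (-1 : ℝ) 1, 0 ≤ (Lagrange.nodal R id * Lagrange.nodal B id).eval t := by
    intro R hR t ht
    rw [hR]
    simp only [eval_mul, eval_pow, eval_add, eval_one, eval_X]
    have h1 : 0 ≤ 1 + t := by linarith [ht.1]
    rw [mul_assoc]
    exact mul_nonneg (pow_nonneg h1 _) (mul_self_nonneg _)
  obtain ⟨R, hBR, hRI, hRc, hRN⟩ : ∃ R : Finset ℝ, B ⊆ R ∧ (∀ r ∈ R, r ∈ Set.Ico (-1 : ℝ) 1) ∧
      R.card = k + ε ∧ Lagrange.nodal R id = (1 + X) ^ ε * Lagrange.nodal B id := by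
    rcases Nat.le_one_iff_eq_zero_or_eq_one.1 hε with rfl | rfl
    · exact ⟨B, subset_rfl, fun r hr => Set.Ioo_subset_Ico_self (hB r hr), hBcard, by simp⟩
    · have hnot : (-1 : ℝ) ∉ B := fun h => lt_irrefl _ (hB _ h).1
      refine ⟨insert (-1) B, Finset.subset_insert _ _, fun r hr => ?_, ?_, ?_⟩
      · rcases Finset.mem_insert.1 hr with rfl | hr
        · norm_num
        · exact Set.Ioo_subset_Ico_self (hB r hr)
      · rw [Finset.card_insert_of_notMem hnot, hBcard]
      · rw [Lagrange.nodal_insert_eq_nodal hnot, id, C_neg, C_1, pow_one]; ring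
  refine ⟨R, B, p.leadingCoeff, hBR, hRI, hB, hRc, hBcard, hlc, ?_, hsign R hRN⟩
  rw [hp, hRN]
  conv_lhs => rw [hpB]
  ring

end Location

/-! ### The quadrature formula and the energy bound -/

section Quadrature

theorem lagrangePoly_eq_nodal {r : ℕ} (α : Fin r → ℝ) (i : Fin r) :
    lagrangePoly α i = Lagrange.nodal (Finset.univ.erase i) α := rfl

theorem lagrangePoly_natDegree {r : ℕ} (α : Fin r → ℝ) (i : Fin r) :
    (lagrangePoly α i).natDegree = r - 1 := by
  rw [lagrangePoly_eq_nodal, Lagrange.natDegree_nodal, Finset.card_erase_of_mem (Finset.mem_univ i),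
    Finset.card_univ, Fintype.card_fin]

theorem lagrangePoly_eval_of_ne {r : ℕ} (α : Fin r → ℝ) {i j : Fin r} (hij : j ≠ i) :
    (lagrangePoly α i).eval (α j) = 0 :=
  Lagrange.eval_nodal_at_node (Finset.mem_erase.2 ⟨hij, Finset.mem_univ j⟩)

theorem lagrangePoly_eval_self_ne_zero {r : ℕ} {α : Fin r → ℝ} (hα : Function.Injective α)
    (i : Fin r) : (lagrangePoly α i).eval (α i) ≠ 0 :=
  Lagrange.eval_nodal_not_at_node fun _ hj => hα.ne (Finset.ne_of_mem_erase hj).symm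

/-- Lagrange interpolation reproduces polynomials of degree less than the number of nodes. -/
theorem eq_sum_lagrangePoly {r : ℕ} {α : Fin r → ℝ} (hα : Function.Injective α) {b : ℝ[X]}
    (hb : b.degree < r) :
    b = ∑ i, C (b.eval (α i) / (lagrangePoly α i).eval (α i)) * lagrangePoly α i := by
  refine eq_of_degrees_lt_of_eval_index_eq Finset.univ hα.injOn (v := α)
    (by simpa using hb) ?_ fun j _ => ?_
  · rw [Finset.card_univ, Fintype.card_fin]
    refine (degree_sum_le _ _).trans_lt ?_
    refine (Finset.sup_lt_iff (WithBot.bot_lt_coe r)).2 fun i _ => ?_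
    rw [← smul_eq_C_mul]
    refine (degree_smul_le _ _).trans_lt ?_
    rw [lagrangePoly_eq_nodal, Lagrange.degree_nodal,
      Finset.card_erase_of_mem (Finset.mem_univ i), Finset.card_univ, Fintype.card_fin]
    have := i.pos
    exact WithBot.coe_lt_coe.2 (by simp only [Nat.cast_id]; omega)
  · rw [eval_finsetSum, Finset.sum_eq_single j]
    · rw [eval_mul, eval_C, div_mul_cancel₀ _ (lagrangePoly_eval_self_ne_zero hα j)]
    · intro i _ hij
      rw [eval_mul, lagrangePoly_eval_of_ne α hij.symm, mul_zero]
    · simp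

/-- The Gauss-type quadrature formula: division by the nodal polynomial leaves a remainder of degree
less than the number of nodes, for which the formula holds by the choice of the weights. -/
theorem gegenbauerMean_eq_quadrature {n N : ℕ} {CW : WeightedSphericalCode n N} {k ε : ℕ}
    (hd : CW.IsDesign (2 * k - 1 + ε)) (hn : 2 ≤ n) (hk : 1 ≤ k) (hε : ε ≤ 1)
    (hM : 0 < CW.effectiveSize) {R : Finset ℝ} {c : ℝ} (hc : c ≠ 0) (hRc : R.card = k + ε)
    (hq : nodePoly n k ε CW.effectiveSize = C c * Lagrange.nodal R id)
    {α ρ : Fin (k + ε) → ℝ} (hα : Function.Injective α) (hαR : ∀ i, α i ∈ R)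
    (hρ : ∀ i, gegenbauerCoeff n hn (lagrangePoly α i) 0 =
      (lagrangePoly α i).eval 1 / CW.effectiveSize + ρ i * (lagrangePoly α i).eval (α i))
    {f : ℝ[X]} (hf : f.natDegree ≤ 2 * k - 1 + ε) :
    gegenbauerMean n hn f - f.eval 1 / CW.effectiveSize = ∑ i, ρ i * f.eval (α i) := by
  set Q := Lagrange.nodal R (id : ℝ → ℝ) with hQ
  have hQm : Q.Monic := Lagrange.nodal_monic
  have hQd : Q.natDegree = k + ε := by rw [hQ, Lagrange.natDegree_nodal, hRc]
  set a := f /ₘ Q with ha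
  set b := f %ₘ Q with hb
  have hfab : f = Q * a + b := by rw [add_comm]; exact (modByMonic_add_div f Q).symm
  have had : a.natDegree ≤ k - 1 := by rw [ha, natDegree_divByMonic f hQm, hQd]; omega
  have hbd : b.degree < ((k + ε : ℕ) : WithBot ℕ) := by
    have := degree_modByMonic_lt f hQm
    rwa [degree_eq_natDegree hQm.ne_zero, hQd] at this
  have hQa : gegenbauerMean n hn (Q * a) - (Q * a).eval 1 / CW.effectiveSize = 0 := by
    have h1 := hd.energy_nodePoly_mul hn hk hε hM (f := C c⁻¹ * a)
      ((natDegree_C_mul_le _ _).trans had)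
    have h2 : nodePoly n k ε CW.effectiveSize * (C c⁻¹ * a) = Q * a := by
      have h3 : C c * C c⁻¹ = (1 : ℝ[X]) := by rw [← C_mul, mul_inv_cancel₀ hc, C_1]
      rw [hq]
      linear_combination (Q * a) * h3
    rwa [h2, hd.energy_eval hn (natDegree_mul_le.trans (by omega))] at h1
  have hbe : gegenbauerMean n hn b - b.eval 1 / CW.effectiveSize = ∑ i, ρ i * b.eval (α i) := by
    have hsum := eq_sum_lagrangePoly hα hbd
    have h1 : gegenbauerMean n hn b = ∑ i, b.eval (α i) / (lagrangePoly α i).eval (α i) *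
        gegenbauerMean n hn (lagrangePoly α i) := by
      conv_lhs => rw [hsum]
      simp only [map_sum, ← smul_eq_C_mul, map_smul, smul_eq_mul]
    have h2 : b.eval 1 = ∑ i, b.eval (α i) / (lagrangePoly α i).eval (α i) *
        (lagrangePoly α i).eval 1 := by
      conv_lhs => rw [hsum]
      simp only [eval_finsetSum, eval_mul, eval_C]
    rw [h1, h2, Finset.sum_div, ← Finset.sum_sub_distrib]
    refine Finset.sum_congr rfl fun i _ => ?_
    have h3 := hρ i
    rw [gegenbauerCoeff_zero_eq] at h3
    have h4 := lagrangePoly_eval_self_ne_zero hα i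
    rw [h3]
    field_simp
    ring
  have hQα : ∀ i, Q.eval (α i) = 0 := fun i => by
    simpa using Lagrange.eval_nodal_at_node (v := (id : ℝ → ℝ)) (hαR i)
  have hval : ∀ i, f.eval (α i) = b.eval (α i) := fun i => by
    conv_lhs => rw [hfab]
    rw [eval_add, eval_mul, hQα, zero_mul, zero_add]
  simp only [hval, ← hbe]
  conv_lhs => rw [hfab]
  rw [map_add, eval_add, add_div]
  linear_combination hQa

end Quadrature

theorem theorem5p1 (n : ℕ) (hn : 2 ≤ n) (k ε τ : ℕ) (hk : 1 ≤ k) (hε : ε ≤ 1)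
    (hτ : τ = 2 * k - 1 + ε) (N : ℕ) (CW : WeightedSphericalCode n N) (hdesign : CW.IsDesign τ)
    (hlower : (dgsBound n τ : ℝ) < CW.effectiveSize)
    (hupper : CW.effectiveSize ≤ (dgsBound n (τ + 1) : ℝ))
    (h : ℝ → ℝ) (hcont : ContinuousOn h (Set.Ico (-1) 1))
    (hdiff : ∀ j ≤ τ, DifferentiableOn ℝ (iteratedDeriv j h) (Set.Ioo (-1) 1))
    (hnonneg : ∀ t ∈ Set.Ioo (-1 : ℝ) 1, 0 ≤ iteratedDeriv (τ + 1) h t) :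
    (∃ α ρ : Fin (k + ε) → ℝ, IsLevenshteinParameters n hn k ε CW.effectiveSize α ρ) ∧
    ∀ α ρ : Fin (k + ε) → ℝ, IsLevenshteinParameters n hn k ε CW.effectiveSize α ρ →
      (∀ i, α i ∈ Set.Ico (-1 : ℝ) 1) ∧
      ∑ i, ρ i * h (α i) ≤ CW.energy h ∧
      IsGreatest
        {b : ℝ | ∃ f : ℝ[X], f.natDegree ≤ τ ∧ (∀ t ∈ Set.Ico (-1 : ℝ) 1, f.eval t ≤ h t) ∧
          b = gegenbauerCoeff n hn f 0 - f.eval 1 * ∑ i, CW.weight i ^ 2}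
        (∑ i, ρ i * h (α i)) := by
  subst hτ
  have hM := (kernelPoly_eval_one_le_dgsBound hn hk hε).trans_lt hlower
  have hM0 : 0 < CW.effectiveSize := (kernelPoly_eval_one_pos hn _).trans hM
  obtain ⟨R, B, c, hBR, hR, hB, hRc, hBc, hc, hq, hW⟩ := hdesign.exists_nodes hn hk hε hlower
  have hnodes : levenshteinNodes n k ε CW.effectiveSize = R := by
    rw [levenshteinNodes_eq hn hk hε hM, hq]
    ext s
    simp [hc, Lagrange.eval_nodal, Finset.prod_eq_zero_iff, sub_eq_zero]
  refine ⟨?_, ?_⟩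
  · have hinj : Function.Injective (R.orderEmbOfFin hRc) := (R.orderEmbOfFin hRc).injective
    refine ⟨R.orderEmbOfFin hRc, fun i =>
      (gegenbauerCoeff n hn (lagrangePoly (R.orderEmbOfFin hRc) i) 0 -
        (lagrangePoly (R.orderEmbOfFin hRc) i).eval 1 / CW.effectiveSize) /
          (lagrangePoly (R.orderEmbOfFin hRc) i).eval (R.orderEmbOfFin hRc i),
      (R.orderEmbOfFin hRc).strictMono, ?_, fun i => ?_⟩
    · rw [hnodes, Finset.range_orderEmbOfFin]
    · rw [div_mul_cancel₀ _ (lagrangePoly_eval_self_ne_zero hinj i)]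
      ring
  · rintro α ρ ⟨hmono, hrange, hρ⟩
    have hrangeR : Set.range α = R := hrange.trans hnodes
    have hαR : ∀ i, α i ∈ R := fun i => by
      rw [← Finset.mem_coe, ← hrangeR]; exact Set.mem_range_self i
    have hquad : ∀ f : ℝ[X], f.natDegree ≤ 2 * k - 1 + ε →
        gegenbauerMean n hn f - f.eval 1 / CW.effectiveSize = ∑ i, ρ i * f.eval (α i) :=
      fun f hf => gegenbauerMean_eq_quadrature hdesign hn hk hε hM0 hc hRc hq hmono.injective
        hαR hρ hf
    -- the energy of `ℓ_i²` is nonnegative and equals `ρ_i ℓ_i(α_i)²`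
    have hρ0 : ∀ i, 0 ≤ ρ i := by
      intro i
      have hdeg : (lagrangePoly α i * lagrangePoly α i).natDegree ≤ 2 * k - 1 + ε :=
        natDegree_mul_le.trans (by rw [lagrangePoly_natDegree]; omega)
      have h1 := hquad _ hdeg
      rw [← hdesign.energy_eval hn hdeg, Finset.sum_eq_single i
        (fun j _ hj => by rw [eval_mul, lagrangePoly_eval_of_ne α hj, mul_zero, mul_zero])
        (by simp), eval_mul] at h1
      have h2 : 0 ≤ CW.energy fun t => (lagrangePoly α i * lagrangePoly α i).eval t :=
        CW.energy_nonneg fun t _ => by rw [eval_mul]; exact mul_self_nonneg _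
      rw [h1] at h2
      exact nonneg_of_mul_nonneg_left h2
        (mul_self_pos.2 (lagrangePoly_eval_self_ne_zero hmono.injective i))
    obtain ⟨f, hfd, hfR, hfh⟩ := exists_hermite_le R B hBR hR hB (by omega) hW hcont hdiff hnonneg
    have hfsum : gegenbauerMean n hn f - f.eval 1 / CW.effectiveSize = ∑ i, ρ i * h (α i) := by
      rw [hquad f hfd]
      exact Finset.sum_congr rfl fun i _ => by rw [hfR _ (hαR i)]
    refine ⟨fun i => hR _ (hαR i), ?_, ⟨f, hfd, hfh, ?_⟩, ?_⟩
    · rw [← hfsum, ← hdesign.energy_eval hn hfd]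
      exact CW.energy_mono hfh
    · rw [← hfsum, gegenbauerCoeff_zero_eq, CW.sum_weight_sq, mul_one_div]
    · rintro _ ⟨g, hgd, hgh, rfl⟩
      rw [gegenbauerCoeff_zero_eq, CW.sum_weight_sq, mul_one_div, hquad g hgd]
      exact Finset.sum_le_sum fun i _ => mul_le_mul_of_nonneg_left (hgh _ (hR _ (hαR i))) (hρ0 i)

end
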